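/- Let $n\ge 1$ and let $\mathbf a=(a_1,\dots,a_n)\in\mathbb R^n$ have non-negative entries, not all zero. For a real symmetric $n\times n$ matrix $X$ with eigenvalues $\lambda_1(X)\le\dots\le\lambda_n(X)$ put $\mathcal M_{\mathbf a}(X)=\sum_{i=1}^n a_i\lambda_i(X)$. Write $|\mathbf a|=a_1+\dots+a_n$, $\tilde a=|\mathbf a|/n$, $a^*=\min(a_1,a_n)$, $\hat a_1=|\mathbf a|-a_1$, $\hat a_n=|\mathbf a|-a_n$. Assume $a_1\ge\hat a_1$ or $a_n\ge\hat a_n$, and put $$\alpha=\max\bigl(1-\hat a_1/a_1,\ 1-\hat a_n/a_n\bigr)\in[0,1],$$ where a term with zero denominator is read as $-\infty$. Let $\Omega\subset\mathbb R^n$ be a bounded domain, let $f$ be continuous and bounded in $\Omega$, and let $u\in C(\overline\Omega)$ be a viscosity solution of $\mathcal M_{\mathbf a}(D^2u)=f$ in $\Omega$ with $u=g$ on $\partial\Omega$. Assume (S) for some $R>0$: for every $y\in\partial\Omega$ there is a ball $B_R$ of radius $R$ with $y\in\partial B_R$ and $\overline\Omega\subset\overline B_R$. Let $[h]_{\beta,D}=\sup_{x\ne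 y\in D}|h(x)-h(y)|/|x-y|^\beta$ and $\|h\|_{C^\beta(D)}=\sup_D|h|+[h]_{\beta,D}$. Let $\|g\|_{C^{1,\beta}(\partial\Omega)}$ be the infimum of $\sup_\Omega|G|+\sup_\Omega|DG|+[DG]_{\beta,\Omega}$ over all extensions $G\in C^{1,\beta}(\overline\Omega)$ of $g$; $g\in C^{1,\beta}(\partial\Omega)$ means that such an extension exists (for $\beta=0$, $C^{1,0}(\overline\Omega)=C^1(\overline\Omega)$). General estimates. (i) If $g\in C^\beta(\partial\Omega)$ with $\beta\in(0,1]$, then with $\gamma=\min(\alpha,\beta/2)$ we have $u\in C^\gamma(\overline\Omega)$ and $$[u]_{\gamma,\Omega}\le C\bigl(\|g\|_{C^\beta(\partial\Omega)}+\|f\|_{L^\infty(\Omega)}\bigr),$$ where $C>0$ depends only on $n,a^*,\tilde a,R,\beta$. (ii) If in addition $\Omega$ has a uniform Lipschitz boundary with Lipschitz constant $L$, and $g\in C^{1,\beta}(\partial\Omega)$ with $\beta\in[0,1)$, then with $\gamma=\min(\alpha,(1+\beta)/2)$ we have $u\in C^\gamma(\overline\Omega)$ and $$[u]_{\gamma,\Omega}\le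 C\bigl(\|g\|_{C^{1,\beta}(\partial\Omega)}+\|f\|_{L^\infty(\Omega)}\bigr),$$ where $C>0$ depends only on $n,a^*,\tilde a,R,L,\beta$. Estimates with exponent $\alpha$. (i$'$) If $\alpha\in(0,1/2]$ and $g\in C^{2\alpha}(\partial\Omega)$, then $u\in C^\alpha(\overline\Omega)$ and $$[u]_{\alpha,\Omega}\le C\bigl(\|g\|_{C^{2\alpha}(\partial\Omega)}+\|f\|_{L^\infty(\Omega)}\bigr),$$ where $C>0$ depends only on $n,a_1,\hat a_1,a_n,\hat a_n,\tilde a,R,\alpha$. (ii$'$) If $\alpha\in[1/2,1]$, $\Omega$ in addition has a uniform Lipschitz boundary with Lipschitz constant $L$, and $g\in C^{1,2\alpha-1}(\partial\Omega)$, then $$[u]_{\alpha,\Omega}\le C\bigl(\|g\|_{C^{1,2\alpha-1}(\partial\Omega)}+\|f\|_{L^\infty(\Omega)}\bigr),$$ where $C>0$ depends only on $n,a_1,\hat a_1,a_n,\hat a_n,\tilde a,R,\alpha,L$. -/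

import Mathlib

open MeasureTheory Set Topology
open scoped NNReal ENNReal

noncomputable section

/-- `ℝⁿ` with its Euclidean norm. -/
abbrev Rn (n : ℕ) : Type := EuclideanSpace ℝ (Fin n)

/-! ### Weighted partial trace operators (the dimension is `n = m + 1 ≥ 1`) -/

/-- The `i`-th eigenvalue of a real symmetric matrix, in increasing order and with multiplicity
(Mathlib's `eigenvalues₀` lists them in decreasing order). -/
def eigenvalueIncr {n : ℕ} {X : Matrix (Fin n) (Fin n) ℝ} (hX : X.IsHermitian) (i : Fin n) : ℝ :=
  hX.eigenvalues₀ (Fin.cast (Fintype.card_fin n).symm i.rev)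

/-- `M_a(X) = a₁ λ₁(X) + ⋯ + aₙ λₙ(X)`. -/
def weightedTrace {n : ℕ} (a : Fin n → ℝ) {X : Matrix (Fin n) (Fin n) ℝ}
    (hX : X.IsHermitian) : ℝ :=
  ∑ i, a i * eigenvalueIncr hX i

/-- The weights of the class `𝒜̄`: non-negative, not all zero. -/
def IsWeight {n : ℕ} (a : Fin n → ℝ) : Prop :=
  (∀ i, 0 ≤ a i) ∧ ∃ j, 0 < a j

/-- `ã = (a₁ + ⋯ + aₙ) / n`. -/
def weightMean {m : ℕ} (a : Fin (m + 1) → ℝ) : ℝ := (∑ i, a i) / ((m : ℝ) + 1)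

/-- `a* = min(a₁, aₙ)`. -/
def weightStar {m : ℕ} (a : Fin (m + 1) → ℝ) : ℝ := min (a 0) (a (Fin.last m))

/-- The complement `â_j = |a| - a_j`, where `|a| = a₁ + ⋯ + aₙ`. -/
def weightHat {n : ℕ} (a : Fin n → ℝ) (j : Fin n) : ℝ := (∑ i, a i) - a j

/-- `a₁ ≥ â₁` or `aₙ ≥ âₙ`. -/
def IsAsymmetric {m : ℕ} (a : Fin (m + 1) → ℝ) : Prop :=
  weightHat a 0 ≤ a 0 ∨ weightHat a (Fin.last m) ≤ a (Fin.last m)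

/-- `max(1 - â₁/a₁, 1 - âₙ/aₙ)`; a term with zero denominator (and then positive numerator)
has the value `-∞`, so that it does not contribute to the maximum. -/
def asymmetryExponent {m : ℕ} (a : Fin (m + 1) → ℝ) : ℝ :=
  if a 0 = 0 then 1 - weightHat a (Fin.last m) / a (Fin.last m)
  else if a (Fin.last m) = 0 then 1 - weightHat a 0 / a 0
  else max (1 - weightHat a 0 / a 0) (1 - weightHat a (Fin.last m) / a (Fin.last m))

/-! ### Viscosity solutions -/

/-- The quadratic polynomial `u(x₀) + ⟨ξ, x - x₀⟩ + ½ ⟨X (x - x₀), x - x₀⟩`. -/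
def jetPoly {n : ℕ} (u : Rn n → ℝ) (x₀ ξ : Rn n) (X : Matrix (Fin n) (Fin n) ℝ) (x : Rn n) : ℝ :=
  u x₀ + inner ℝ ξ (x - x₀) + (1 / 2) * inner ℝ (Matrix.toEuclideanLin X (x - x₀)) (x - x₀)

/-- For symmetric `X`: `(ξ, X)` belongs to the second order superjet of `u` at `x₀`
relative to `O`. -/
def InSuperjet {n : ℕ} (O : Set (Rn n)) (u : Rn n → ℝ) (x₀ ξ : Rn n)
    (X : Matrix (Fin n) (Fin n) ℝ) : Prop :=
  ∀ ε > 0, ∀ᶠ x in 𝓝[O] x₀, u x ≤ jetPoly u x₀ ξ X x + ε * ‖x - x₀‖ ^ 2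

/-- For symmetric `X`: `(ξ, X)` belongs to the second order subjet of `u` at `x₀`
relative to `O`. -/
def InSubjet {n : ℕ} (O : Set (Rn n)) (u : Rn n → ℝ) (x₀ ξ : Rn n)
    (X : Matrix (Fin n) (Fin n) ℝ) : Prop :=
  ∀ ε > 0, ∀ᶠ x in 𝓝[O] x₀, jetPoly u x₀ ξ X x - ε * ‖x - x₀‖ ^ 2 ≤ u x

/-- `u` is a viscosity subsolution of `M_a(D²u) = f` in `O`. -/
def IsViscositySubsolution {n : ℕ} (a : Fin n → ℝ) (O : Set (Rn n)) (f u : Rn n → ℝ) : Prop :=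
  UpperSemicontinuousOn u O ∧
    ∀ x ∈ O, ∀ (ξ : Rn n) (X : Matrix (Fin n) (Fin n) ℝ) (hX : X.IsHermitian),
      InSuperjet O u x ξ X → f x ≤ weightedTrace a hX

/-- `u` is a viscosity supersolution of `M_a(D²u) = f` in `O`. -/
def IsViscositySupersolution {n : ℕ} (a : Fin n → ℝ) (O : Set (Rn n)) (f u : Rn n → ℝ) : Prop :=
  LowerSemicontinuousOn u O ∧
    ∀ x ∈ O, ∀ (ξ : Rn n) (X : Matrix (Fin n) (Fin n) ℝ) (hX : X.IsHermitian),
      InSubjet O u x ξ X → weightedTrace a hX ≤ f x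

/-- `Ω` is a bounded domain, `f` is continuous and bounded in `Ω`, and `u ∈ C(Ω̄)` is a viscosity
solution of `M_a(D²u) = f` in `Ω` with `u = g` on `∂Ω`. -/
structure IsDirichletSolution {n : ℕ} (a : Fin n → ℝ) (Ω : Set (Rn n)) (f g u : Rn n → ℝ) :
    Prop where
  isOpen : IsOpen Ω
  isConnected : IsConnected Ω
  isBounded : Bornology.IsBounded Ω
  continuousOn_rhs : ContinuousOn f Ω
  bounded_rhs : ∃ M : ℝ, ∀ x ∈ Ω, |f x| ≤ M
  continuousOn : ContinuousOn u (closure Ω)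
  subsolution : IsViscositySubsolution a Ω f u
  supersolution : IsViscositySupersolution a Ω f u
  boundary : ∀ x ∈ frontier Ω, u x = g x

/-! ### Conditions on the domain -/

/-- Condition (S): for every `y ∈ ∂Ω` there is a ball `B_R` of radius `R` with `y ∈ ∂B_R` and
`Ω̄ ⊆ B̄_R`. -/
def UniformExteriorSphere {n : ℕ} (Ω : Set (Rn n)) (R : ℝ) : Prop :=
  ∀ y ∈ frontier Ω, ∃ c : Rn n,
    y ∈ Metric.sphere c R ∧ closure Ω ⊆ Metric.closedBall c R

/-- Uniform Lipschitz boundary with constant `L`: in a ball of fixed radius around each boundary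
point, `Ω` is the strict epigraph, in some direction `ν`, of an `L`-Lipschitz function of the
variables orthogonal to `ν`. -/
def UniformLipschitzBoundary {n : ℕ} (Ω : Set (Rn n)) (L : ℝ≥0) : Prop :=
  ∃ r > 0, ∀ y ∈ frontier Ω, ∃ (ν : Rn n) (φ : Rn n → ℝ),
    ‖ν‖ = 1 ∧ LipschitzWith L φ ∧ (∀ (x : Rn n) (s : ℝ), φ (x + s • ν) = φ x) ∧
    Ω ∩ Metric.ball y r = {x | x ∈ Metric.ball y r ∧ φ x < inner ℝ ν x}

/-! ### Hölder norms -/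

/-- `sup_D ‖h‖`. -/
def supNormOn {n : ℕ} {F : Type} [NormedAddCommGroup F] (D : Set (Rn n)) (h : Rn n → F) : ℝ≥0∞ :=
  ⨆ x ∈ D, ‖h x‖ₑ

/-- The Hölder seminorm `[h]_{β, D}`, for an exponent `β ≥ 0`. -/
def holderSeminorm {n : ℕ} {F : Type} [NormedAddCommGroup F] (β : ℝ) (D : Set (Rn n))
    (h : Rn n → F) : ℝ≥0∞ :=
  eHolderNorm β.toNNReal (fun x : D => h x)

/-- The norm of `C^β(D)`. -/
def holderNorm {n : ℕ} (β : ℝ) (D : Set (Rn n)) (h : Rn n → ℝ) : ℝ≥0∞ :=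
  supNormOn D h + holderSeminorm β D h

/-- `h ∈ C^β(D)`, for compact `D` and continuous `h`. -/
def HolderOn {n : ℕ} (β : ℝ) (D : Set (Rn n)) (h : Rn n → ℝ) : Prop :=
  ContinuousOn h D ∧ holderNorm β D h < ∞

/-- `G`, with gradient `V`, is a `C¹(Ω̄)` extension of the boundary function `g`. -/
structure IsC1Extension {n : ℕ} (Ω : Set (Rn n)) (g G : Rn n → ℝ) (V : Rn n → Rn n) : Prop where
  continuousOn : ContinuousOn G (closure Ω)
  continuousOn_grad : ContinuousOn V (closure Ω)
  hasGradientAt : ∀ x ∈ Ω, HasGradientAt G (V x) x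
  eq_boundary : ∀ x ∈ frontier Ω, G x = g x

/-- The norm of `C^{1,β}(∂Ω)`, that is the infimum of
`‖G‖_{C^{1,β}(Ω̄)} = sup |G| + sup |DG| + [DG]_β` over the extensions `G` of `g` to `Ω̄`;
it is `∞` if there is no extension of class `C^{1,β}(Ω̄)`. -/
def boundaryC1HolderNorm {n : ℕ} (β : ℝ) (Ω : Set (Rn n)) (g : Rn n → ℝ) : ℝ≥0∞ :=
  ⨅ (G : Rn n → ℝ) (V : Rn n → Rn n) (_ : IsC1Extension Ω g G V),
    supNormOn (closure Ω) G + supNormOn (closure Ω) V + holderSeminorm β (closure Ω) V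

/-- `‖f‖_{L^∞(Ω)}`. -/
def linftyNorm {n : ℕ} (Ω : Set (Rn n)) (f : Rn n → ℝ) : ℝ≥0∞ :=
  eLpNorm f ∞ (volume.restrict Ω)

end

/-!
Exterior spheres of one fixed radius at all boundary points force `Ω` to be convex, and `u ↦ -u`
together with the reversal of the weights exchanges the roles of `a₁` and `aₙ`; so it suffices to
bound `u x - u y` from above when `a₁ (γ - 1) + â₁ ≤ 0`.

At a boundary point, the power `H t ^ (τ / 2)` of the affine function `t` that vanishes on the
tangent plane of the enclosing sphere dominates `H ‖z - x‖ ^ τ` on the ball; adding a multiple of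
the defining function of the ball turns it into a strict supersolution above the boundary data, and
this is where half of the exponent of the data is lost. In the interior, `A ‖z - y‖ ^ γ`
has the radial eigenvalue `γ - 1` and the tangential eigenvalues `1`, up to a common positive
factor, and the radial one is the smallest: its weight is `a₁`, so that the operator is
proportional to `a₁ (γ - 1) + â₁ ≤ 0`. Subtracting `k / 2 * ‖z - y‖ ^ 2` makes the function a
strict supersolution away from `y`, and comparison with `u` on `Ω`, for which the barriers supply
the boundary inequality, bounds `u - u y`.
-/

noncomputable section

open Filter Asymptotics InnerProductSpace

/-! ### Eigenvalues and weighted traces -/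

section Eigenvalues

variable {n : ℕ} {X : Matrix (Fin n) (Fin n) ℝ}

/-- An orthonormal basis of eigenvectors of a symmetric matrix, ordered as `eigenvalueIncr`. -/
def eigenbasisIncr (hX : X.IsHermitian) : OrthonormalBasis (Fin n) ℝ (Rn n) :=
  ((Matrix.isSymmetric_toEuclideanLin_iff.mpr hX).eigenvectorBasis
    finrank_euclideanSpace).reindex ((finCongr (Fintype.card_fin n)).trans Fin.revPerm)

theorem toEuclideanLin_eigenbasisIncr (hX : X.IsHermitian) (i : Fin n) :
    Matrix.toEuclideanLin X (eigenbasisIncr hX i) = eigenvalueIncr hX i • eigenbasisIncr hX i := by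
  have h := (Matrix.isSymmetric_toEuclideanLin_iff.mpr hX).apply_eigenvectorBasis
    finrank_euclideanSpace (Fin.cast (Fintype.card_fin n).symm i.rev)
  rw [eigenbasisIncr, OrthonormalBasis.reindex_apply]
  exact h

theorem eigenvalueIncr_monotone (hX : X.IsHermitian) : Monotone (eigenvalueIncr hX) :=
  fun _ _ hij => hX.eigenvalues₀_antitone (Fin.rev_le_rev.mpr hij)

theorem roots_charpoly_of_eigenbasis {ι K V : Type*} [Fintype ι] [Field K]
    [AddCommGroup V] [Module K V] [FiniteDimensional K V] {T : Module.End K V} {μ : ι → K}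
    (b : Module.Basis ι K V) (hb : ∀ i, T (b i) = μ i • b i) :
    T.charpoly.roots = Finset.univ.val.map μ := by
  classical
  have hdiag : LinearMap.toMatrix b b T = Matrix.diagonal μ := by
    ext i j
    rcases eq_or_ne i j with rfl | hij <;> simp [LinearMap.toMatrix_apply, *]
  rw [← LinearMap.charpoly_toMatrix _ b, hdiag, Matrix.charpoly_diagonal,
    Polynomial.roots_prod _ _ (Finset.prod_ne_zero_iff.mpr fun i _ => Polynomial.X_sub_C_ne_zero _)]
  simp only [Polynomial.roots_X_sub_C, Multiset.bind_singleton]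

theorem eigenvalueIncr_eq_of_eigenbasis (hX : X.IsHermitian) {μ : Fin n → ℝ} (hμ : Monotone μ)
    (b : Module.Basis (Fin n) ℝ (Rn n))
    (hb : ∀ i, Matrix.toEuclideanLin X (b i) = μ i • b i) : eigenvalueIncr hX = μ := by
  have hroots := (roots_charpoly_of_eigenbasis (eigenbasisIncr hX).toBasis fun i => by
    simpa using toEuclideanLin_eigenbasisIncr hX i).symm.trans (roots_charpoly_of_eigenbasis b hb)
  rw [Fin.univ_val_map, Fin.univ_val_map] at hroots
  exact List.ofFn_injective <| List.Perm.eq_of_sortedLE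
    (eigenvalueIncr_monotone hX).sortedLE_ofFn hμ.sortedLE_ofFn (Multiset.coe_eq_coe.mp hroots)

theorem eigenvalueIncr_neg (hX : X.IsHermitian) (i : Fin n) :
    eigenvalueIncr hX.neg i = -eigenvalueIncr hX i.rev := by
  refine congrFun (eigenvalueIncr_eq_of_eigenbasis hX.neg
    (μ := fun i => -eigenvalueIncr hX i.rev)
    (fun i j hij => neg_le_neg (eigenvalueIncr_monotone hX (Fin.rev_le_rev.mpr hij)))
    ((eigenbasisIncr hX).toBasis.reindex Fin.revPerm) fun i => ?_) i
  simp [toEuclideanLin_eigenbasisIncr]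

theorem eigenvalueIncr_of_eq_smul_one (hX : X.IsHermitian) {k : ℝ} (h : X = k • 1) (i : Fin n) :
    eigenvalueIncr hX i = k := by
  refine congrFun (eigenvalueIncr_eq_of_eigenbasis hX (μ := fun _ => k) monotone_const
    (EuclideanSpace.basisFun _ ℝ).toBasis fun i => ?_) i
  simp [h]

theorem weightedTrace_neg (a : Fin n → ℝ) (hX : X.IsHermitian) :
    weightedTrace a hX.neg = -weightedTrace (a ∘ Fin.rev) hX := by
  simp only [weightedTrace, eigenvalueIncr_neg hX, mul_neg, Finset.sum_neg_distrib, neg_inj]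
  exact Fintype.sum_equiv Fin.revPerm _ _ fun i => by simp

theorem weightedTrace_of_eq_smul_one (a : Fin n → ℝ) (hX : X.IsHermitian) {k : ℝ}
    (h : X = k • 1) : weightedTrace a hX = k * ∑ i, a i := by
  simp only [weightedTrace, eigenvalueIncr_of_eq_smul_one hX h, Finset.mul_sum, mul_comm]

theorem inner_toEuclideanLin_eigenbasisIncr (hX : X.IsHermitian) (v : Rn n) :
    inner ℝ (Matrix.toEuclideanLin X v) v =
      ∑ i, eigenvalueIncr hX i * inner ℝ (eigenbasisIncr hX i) v ^ 2 := by
  rw [← (eigenbasisIncr hX).sum_inner_mul_inner]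
  refine Finset.sum_congr rfl fun i _ => ?_
  rw [Matrix.isSymmetric_toEuclideanLin_iff.mpr hX, toEuclideanLin_eigenbasisIncr,
    real_inner_smul_right, real_inner_comm, mul_assoc, sq]

theorem eigenvalueIncr_le (hX : X.IsHermitian) {M : ℝ}
    (hM : ∀ v : Rn n, inner ℝ (Matrix.toEuclideanLin X v) v ≤ M * ‖v‖ ^ 2) (i : Fin n) :
    eigenvalueIncr hX i ≤ M := by
  simpa [toEuclideanLin_eigenbasisIncr, real_inner_smul_left] using hM (eigenbasisIncr hX i)

theorem eigenvalueIncr_zero_mul_norm_sq_le {m : ℕ} {X : Matrix (Fin (m + 1)) (Fin (m + 1)) ℝ}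
    (hX : X.IsHermitian) (v : Rn (m + 1)) :
    eigenvalueIncr hX 0 * ‖v‖ ^ 2 ≤ inner ℝ (Matrix.toEuclideanLin X v) v := by
  rw [inner_toEuclideanLin_eigenbasisIncr hX, ← (eigenbasisIncr hX).sum_sq_inner_right,
    Finset.mul_sum]
  exact Finset.sum_le_sum fun i _ => mul_le_mul_of_nonneg_right
    (eigenvalueIncr_monotone hX (Fin.zero_le i)) (sq_nonneg _)

theorem weightHat_eq_sum_erase (a : Fin n → ℝ) (j : Fin n) :
    weightHat a j = ∑ i ∈ Finset.univ.erase j, a i := by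
  rw [weightHat, ← Finset.add_sum_erase _ _ (Finset.mem_univ j), add_sub_cancel_left]

theorem weightedTrace_le {m : ℕ} {X : Matrix (Fin (m + 1)) (Fin (m + 1)) ℝ}
    (hX : X.IsHermitian) {a : Fin (m + 1) → ℝ} (ha : ∀ i, 0 ≤ a i) {M q : ℝ}
    (hM : ∀ v : Rn (m + 1), inner ℝ (Matrix.toEuclideanLin X v) v ≤ M * ‖v‖ ^ 2)
    {e : Rn (m + 1)} (he : ‖e‖ = 1) (hq : inner ℝ (Matrix.toEuclideanLin X e) e ≤ q) :
    weightedTrace a hX ≤ a 0 * q + weightHat a 0 * M := by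
  have hfirst : eigenvalueIncr hX 0 ≤ q := by
    simpa [he] using (eigenvalueIncr_zero_mul_norm_sq_le hX e).trans hq
  rw [weightedTrace, ← Finset.add_sum_erase _ _ (Finset.mem_univ 0), weightHat_eq_sum_erase,
    Finset.sum_mul]
  exact add_le_add (mul_le_mul_of_nonneg_left hfirst (ha 0))
    (Finset.sum_le_sum fun i _ => mul_le_mul_of_nonneg_left (eigenvalueIncr_le hX hM i) (ha i))

end Eigenvalues

section Weights

variable {m : ℕ} {a : Fin (m + 1) → ℝ}

theorem sum_comp_rev {n : ℕ} (a : Fin n → ℝ) : ∑ i, (a ∘ Fin.rev) i = ∑ i, a i :=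
  Equiv.sum_comp Fin.revPerm a

theorem weightHat_comp_rev {n : ℕ} (a : Fin n → ℝ) (j : Fin n) :
    weightHat (a ∘ Fin.rev) j = weightHat a j.rev := by
  rw [weightHat, weightHat, sum_comp_rev, Function.comp_apply]

theorem IsWeight.sum_pos {n : ℕ} {a : Fin n → ℝ} (ha : IsWeight a) : 0 < ∑ i, a i :=
  let ⟨j, hj⟩ := ha.2
  Finset.sum_pos' (fun i _ => ha.1 i) ⟨j, Finset.mem_univ j, hj⟩

theorem le_one_sub_div_iff {p q γ : ℝ} (hp : 0 < p) : γ ≤ 1 - q / p ↔ p * (γ - 1) + q ≤ 0 := by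
  rw [le_sub_comm, div_le_iff₀ hp]
  constructor <;> intro h <;> linarith

theorem IsWeight.pos_of_isAsymmetric (ha : IsWeight a) (has : IsAsymmetric a) :
    0 < a 0 ∨ 0 < a (Fin.last m) := by
  have := ha.sum_pos
  rcases has with h | h <;> rw [weightHat] at h
  exacts [.inl (by linarith), .inr (by linarith)]

theorem le_asymmetryExponent_iff (ha : IsWeight a) (has : IsAsymmetric a) {γ : ℝ} :
    γ ≤ asymmetryExponent a ↔
      (0 < a 0 ∧ a 0 * (γ - 1) + weightHat a 0 ≤ 0) ∨
        (0 < a (Fin.last m) ∧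
          a (Fin.last m) * (γ - 1) + weightHat a (Fin.last m) ≤ 0) := by
  have hpos := ha.pos_of_isAsymmetric has
  rw [asymmetryExponent]
  split_ifs with h₀ h₁
  · have hl : 0 < a (Fin.last m) := hpos.resolve_left h₀.not_gt
    simp [h₀, hl, le_one_sub_div_iff]
  · have hf : 0 < a 0 := hpos.resolve_right h₁.not_gt
    simp [h₁, hf, le_one_sub_div_iff]
  · have hf := (ha.1 0).lt_of_ne' h₀
    have hl := (ha.1 (Fin.last m)).lt_of_ne' h₁
    simp [hf, hl, le_one_sub_div_iff]

theorem asymmetryExponent_nonneg (ha : IsWeight a) (has : IsAsymmetric a) :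
    0 ≤ asymmetryExponent a := by
  have := ha.sum_pos
  rw [le_asymmetryExponent_iff ha has]
  refine has.imp (fun h => ⟨?_, by linarith⟩) fun h => ⟨?_, by linarith⟩ <;>
  · rw [weightHat] at h
    linarith

end Weights

/-! ### Calculus of superjets -/

section Superjets

variable {n : ℕ} {O : Set (Rn n)} {u w : Rn n → ℝ} {x ξ η : Rn n} {X Y : Matrix (Fin n) (Fin n) ℝ}

theorem inSuperjet_of_isLittleO
    (h : (fun z => u z - jetPoly u x ξ X z) =o[𝓝 x] fun z => ‖z - x‖ ^ 2) :
    InSuperjet O u x ξ X := by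
  intro ε hε
  filter_upwards [nhdsWithin_le_nhds (h.def hε)] with z hz
  rw [norm_pow, norm_norm] at hz
  linarith [le_of_abs_le hz]

theorem inSuperjet_inner (V x : Rn n) : InSuperjet O (fun z => inner ℝ V z) x V 0 :=
  inSuperjet_of_isLittleO <| (isLittleO_zero _ _).congr_left fun z => by
    simp [jetPoly, inner_sub_right]

theorem inSuperjet_mul_norm_sub_sq (k : ℝ) (y x : Rn n) :
    InSuperjet O (fun z => k * ‖z - y‖ ^ 2) x ((2 * k) • (x - y)) ((2 * k) • 1) := by
  refine inSuperjet_of_isLittleO <| (isLittleO_zero _ _).congr_left fun z => ?_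
  have hsq : ‖z - y‖ ^ 2 = ‖x - y‖ ^ 2 + 2 * inner ℝ (x - y) (z - x) + ‖z - x‖ ^ 2 := by
    rw [← norm_add_sq_real, sub_add_sub_cancel']
  simp only [jetPoly, hsq, map_smul, Matrix.toLpLin_one, LinearMap.smul_apply, LinearMap.id_apply,
    real_inner_smul_left, real_inner_self_eq_norm_sq]
  ring

theorem InSuperjet.of_sub_le (h : InSuperjet O w x ξ X)
    (hle : ∀ z ∈ O, u z - u x ≤ w z - w x) : InSuperjet O u x ξ X := by
  intro ε hε
  filter_upwards [h ε hε, self_mem_nhdsWithin] with z hz hzO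
  rw [jetPoly] at hz ⊢
  linarith [hle z hzO]

theorem InSuperjet.add (hu : InSuperjet O u x ξ X) (hw : InSuperjet O w x η Y) :
    InSuperjet O (fun z => u z + w z) x (ξ + η) (X + Y) := by
  intro ε hε
  filter_upwards [hu (ε / 2) (half_pos hε), hw (ε / 2) (half_pos hε)] with z hzu hzw
  simp only [jetPoly, map_add, LinearMap.add_apply, inner_add_left] at hzu hzw ⊢
  linarith

theorem InSuperjet.const_mul {A : ℝ} (hA : 0 ≤ A) (h : InSuperjet O u x ξ X) :
    InSuperjet O (fun z => A * u z) x (A • ξ) (A • X) := by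
  intro ε hε
  filter_upwards [h (ε / (A + 1)) (by positivity)] with z hz
  have hε' : A * (ε / (A + 1)) ≤ ε := by
    rw [mul_div_left_comm]
    exact mul_le_of_le_one_right hε.le (div_le_one_of_le₀ (by linarith) (by positivity))
  simp only [jetPoly, map_smul, LinearMap.smul_apply, real_inner_smul_left] at hz ⊢
  linarith [mul_le_mul_of_nonneg_left hz hA, mul_le_mul_of_nonneg_right hε' (sq_nonneg ‖z - x‖)]

theorem rpow_sub_rpow_le_tangent {σ s t : ℝ} (hσ₀ : 0 ≤ σ) (hσ₁ : σ ≤ 1) (hs : 0 < s)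
    (ht : 0 ≤ t) : t ^ σ - s ^ σ ≤ σ * s ^ (σ - 1) * (t - s) := by
  have hbernoulli := rpow_one_add_le_one_add_mul_self (s := t / s - 1)
    (by linarith [div_nonneg ht hs.le]) hσ₀ hσ₁
  rw [add_sub_cancel, Real.div_rpow ht hs.le, div_le_iff₀ (by positivity)] at hbernoulli
  calc t ^ σ - s ^ σ ≤ σ * (t / s - 1) * s ^ σ := by linarith
    _ = σ * s ^ (σ - 1) * (t - s) := by
        rw [Real.rpow_sub_one hs.ne']
        field_simp

theorem InSuperjet.rpow {σ : ℝ} (hσ₀ : 0 ≤ σ) (hσ₁ : σ ≤ 1) (h : InSuperjet O u x ξ X)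
    (hux : 0 < u x) (hu : ∀ z ∈ O, 0 ≤ u z) :
    InSuperjet O (fun z => u z ^ σ) x ((σ * u x ^ (σ - 1)) • ξ) ((σ * u x ^ (σ - 1)) • X) := by
  refine (h.const_mul (A := σ * u x ^ (σ - 1)) (by positivity)).of_sub_le fun z hz => ?_
  rw [← mul_sub]
  exact rpow_sub_rpow_le_tangent hσ₀ hσ₁ hux (hu z hz)

theorem InSuperjet.neg (h : InSuperjet O u x ξ X) :
    InSubjet O (fun z => -u z) x (-ξ) (-X) := by
  intro ε hε
  filter_upwards [h ε hε] with z hz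
  simp only [jetPoly, map_neg, LinearMap.neg_apply, inner_neg_left] at hz ⊢
  linarith

theorem InSubjet.neg (h : InSubjet O u x ξ X) :
    InSuperjet O (fun z => -u z) x (-ξ) (-X) := by
  intro ε hε
  filter_upwards [h ε hε] with z hz
  simp only [jetPoly, map_neg, LinearMap.neg_apply, inner_neg_left] at hz ⊢
  linarith

end Superjets

section Solutions

variable {n : ℕ} {a : Fin n → ℝ} {Ω : Set (Rn n)} {f g u : Rn n → ℝ}

theorem IsDirichletSolution.neg (h : IsDirichletSolution a Ω f g u) :
    IsDirichletSolution (a ∘ Fin.rev) Ω (fun x => -f x) (fun x => -g x) (fun x => -u x) where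
  isOpen := h.isOpen
  isConnected := h.isConnected
  isBounded := h.isBounded
  continuousOn_rhs := h.continuousOn_rhs.neg
  bounded_rhs := by simpa using h.bounded_rhs
  continuousOn := h.continuousOn.neg
  subsolution := by
    refine ⟨(h.continuousOn.neg.mono subset_closure).upperSemicontinuousOn, ?_⟩
    intro x hx ξ X hX hjet
    have := h.supersolution.2 x hx (-ξ) (-X) hX.neg (by simpa using hjet.neg)
    rw [weightedTrace_neg a hX] at this
    linarith
  supersolution := by
    refine ⟨(h.continuousOn.neg.mono subset_closure).lowerSemicontinuousOn, ?_⟩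
    intro x hx ξ X hX hjet
    have := h.subsolution.2 x hx (-ξ) (-X) hX.neg (by simpa using hjet.neg)
    rw [weightedTrace_neg a hX] at this
    linarith
  boundary x hx := by rw [h.boundary x hx]

theorem IsViscositySubsolution.sub_le_of_forall_strict {K : Set (Rn n)} {w : Rn n → ℝ} (b : ℝ)
    (h : IsViscositySubsolution a Ω f u) (hK : IsCompact K) (hΩK : Ω ⊆ K)
    (hu : ContinuousOn u K) (hw : ContinuousOn w K)
    (hstrict : ∀ x ∈ K, u x - b ≤ w x ∨ x ∈ Ω ∧ ∃ (ξ : Rn n) (X : Matrix (Fin n) (Fin n) ℝ)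
      (hX : X.IsHermitian), InSuperjet Ω w x ξ X ∧ weightedTrace a hX < f x)
    {x : Rn n} (hx : x ∈ K) : u x - b ≤ w x := by
  obtain ⟨x₀, hx₀, hmax⟩ := hK.exists_isMaxOn ⟨x, hx⟩ (hu.sub hw)
  have hmax_le : ∀ z ∈ K, u z - w z ≤ u x₀ - w x₀ := fun z hz => hmax hz
  rcases hstrict x₀ hx₀ with hle | ⟨hx₀Ω, ξ, X, hX, hjet, hlt⟩
  · linarith [hmax_le x hx]
  · refine absurd (h.2 x₀ hx₀Ω ξ X hX (hjet.of_sub_le fun z hz => ?_)) hlt.not_ge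
    linarith [hmax_le z (hΩK hz)]

end Solutions

/-! ### Powers of the distance -/

section Radial

theorem rpow_taylor_two_isLittleO (q : ℝ) {s₀ : ℝ} (hs₀ : 0 < s₀) :
    (fun s : ℝ => s ^ q - (s₀ ^ q + q * s₀ ^ (q - 1) * (s - s₀) +
      q * (q - 1) / 2 * s₀ ^ (q - 2) * (s - s₀) ^ 2)) =o[𝓝 s₀] fun s => (s - s₀) ^ 2 := by
  have hsmooth : ContDiffOn ℝ 2 (fun s : ℝ => s ^ q) (Ioi 0) := fun s hs =>
    (Real.contDiffAt_rpow_const (.inl (ne_of_gt hs))).contDiffWithinAt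
  have hderiv (k : ℕ) : iteratedDerivWithin k (fun s : ℝ => s ^ q) (Ioi 0) s₀ =
      (descPochhammer ℝ k).eval q * s₀ ^ (q - k) := by
    rw [iteratedDerivWithin_of_isOpen isOpen_Ioi hs₀, iteratedDeriv_eq_iterate,
      Real.iter_deriv_rpow_const]
  have htaylor := taylor_isLittleO (convex_Ioi 0) hs₀ hsmooth
  rw [isOpen_Ioi.nhdsWithin_eq hs₀] at htaylor
  refine htaylor.congr_left fun s => ?_
  simp only [taylorWithinEval_succ, taylor_within_zero_eval, hderiv, descPochhammer_succ_right,
    descPochhammer_zero]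
  simp
  ring

theorem norm_rpow_eq_norm_sq_rpow_half {E : Type*} [SeminormedAddCommGroup E] (v : E) (γ : ℝ) :
    ‖v‖ ^ γ = (‖v‖ ^ 2) ^ (γ / 2) := by
  rw [← Real.rpow_natCast_mul (norm_nonneg v)]
  congr 1
  push_cast
  ring

theorem norm_rpow_taylor_two_isLittleO {E : Type*} [NormedAddCommGroup E] [InnerProductSpace ℝ E]
    (γ : ℝ) {x₀ : E} (hx₀ : x₀ ≠ 0) :
    (fun h : E => ‖x₀ + h‖ ^ γ - (‖x₀‖ ^ γ + γ * ‖x₀‖ ^ (γ - 2) * (inner ℝ x₀ h +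
      (‖h‖ ^ 2 + (γ - 2) * inner ℝ (‖x₀‖⁻¹ • x₀) h ^ 2) / 2))) =o[𝓝 0] fun h => ‖h‖ ^ 2 := by
  have hpos : 0 < ‖x₀‖ := norm_pos_iff.mpr hx₀
  have hexpand (h : E) : ‖x₀ + h‖ ^ 2 - ‖x₀‖ ^ 2 = 2 * inner ℝ x₀ h + ‖h‖ ^ 2 := by
    rw [norm_add_sq_real]
    ring
  have hincr : (fun h : E => 2 * inner ℝ x₀ h + ‖h‖ ^ 2) =O[𝓝 0] fun h => ‖h‖ := by
    have hinner : (fun h : E => inner ℝ x₀ h) =O[𝓝 0] fun h => ‖h‖ :=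
      .of_bound ‖x₀‖ (.of_forall fun h => by simpa using norm_inner_le_norm (𝕜 := ℝ) x₀ h)
    exact (hinner.const_mul_left 2).add (isLittleO_norm_pow_id one_lt_two).isBigO.norm_right
  have htendsto : Tendsto (fun h : E => ‖x₀ + h‖ ^ 2) (𝓝 0) (𝓝 (‖x₀‖ ^ 2)) := by
    have : Continuous fun h : E => ‖x₀ + h‖ ^ 2 := by fun_prop
    simpa using this.tendsto 0
  have hmain := ((rpow_taylor_two_isLittleO (γ / 2) (pow_pos hpos 2)).comp_tendsto
    htendsto).trans_isBigO ((hincr.pow 2).congr_left fun h => by rw [← hexpand]; rfl)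
  have hrest : (fun h : E => γ / 2 * (γ / 2 - 1) / 2 * ‖x₀‖ ^ (γ - 4) *
      ((4 * inner ℝ x₀ h + ‖h‖ ^ 2) * ‖h‖ ^ 2)) =o[𝓝 0] fun h => ‖h‖ ^ 2 := by
    have hcont : Continuous fun h : E => 4 * inner ℝ x₀ h + ‖h‖ ^ 2 := by fun_prop
    have hzero : (fun h : E => 4 * inner ℝ x₀ h + ‖h‖ ^ 2) =o[𝓝 0] fun _ => (1 : ℝ) :=
      (isLittleO_one_iff ℝ).mpr (by simpa using hcont.tendsto 0)
    simpa using (hzero.mul_isBigO (isBigO_refl (fun h : E => ‖h‖ ^ 2) _)).const_mul_left _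
  have hpow (θ : ℝ) : (‖x₀‖ ^ 2) ^ (θ / 2) = ‖x₀‖ ^ θ := (norm_rpow_eq_norm_sq_rpow_half _ _).symm
  have hsplit : ‖x₀‖ ^ (γ - 2) * ‖x₀‖⁻¹ ^ 2 = ‖x₀‖ ^ (γ - 4) := by
    rw [inv_pow, ← div_eq_mul_inv, ← Real.rpow_sub_natCast hpos.ne']
    norm_num [sub_sub]
  refine (hmain.add hrest).congr_left fun h => ?_
  rw [Function.comp_apply, hexpand, ← norm_rpow_eq_norm_sq_rpow_half, hpow,
    show γ / 2 - 1 = (γ - 2) / 2 by ring, show γ / 2 - 2 = (γ - 4) / 2 by ring, hpow, hpow,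
    real_inner_smul_left, mul_pow]
  linear_combination (γ * (γ - 2) / 2 * inner ℝ x₀ h ^ 2) * hsplit

end Radial

/-- The Hessian of `x ↦ ‖x‖ ^ γ / γ` at a unit vector `e`. -/
def radialHessian {n : ℕ} (γ : ℝ) (e : Rn n) : Matrix (Fin n) (Fin n) ℝ :=
  1 + (γ - 2) • Matrix.vecMulVec e e

theorem isHermitian_radialHessian {n : ℕ} (γ : ℝ) (e : Rn n) : (radialHessian γ e).IsHermitian := by
  rw [radialHessian, Matrix.IsHermitian, Matrix.conjTranspose_eq_transpose_of_trivial]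
  simp [Matrix.transpose_vecMulVec]

theorem inner_radialHessian {n : ℕ} (γ : ℝ) (e v : Rn n) :
    inner ℝ (Matrix.toEuclideanLin (radialHessian γ e) v) v =
      ‖v‖ ^ 2 + (γ - 2) * inner ℝ e v ^ 2 := by
  have h : Matrix.toEuclideanLin (radialHessian γ e) v = v + ((γ - 2) * inner ℝ e v) • e := by
    ext i
    simp [radialHessian, Matrix.toLpLin_apply, Matrix.vecMulVec_mulVec, PiLp.inner_apply,
      dotProduct, mul_comm, mul_left_comm]
  rw [h, inner_add_left, real_inner_smul_left, real_inner_self_eq_norm_sq]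
  ring

theorem inSuperjet_norm_sub_rpow {n : ℕ} {O : Set (Rn n)} (γ : ℝ) {x y : Rn n} (hxy : x ≠ y) :
    InSuperjet O (fun z => ‖z - y‖ ^ γ) x ((γ * ‖x - y‖ ^ (γ - 2)) • (x - y))
      ((γ * ‖x - y‖ ^ (γ - 2)) • radialHessian γ (‖x - y‖⁻¹ • (x - y))) := by
  have htendsto : Tendsto (fun z => z - x) (𝓝 x) (𝓝 0) := tendsto_sub_nhds_zero_iff.mpr tendsto_id
  refine inSuperjet_of_isLittleO <| ((norm_rpow_taylor_two_isLittleO γ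
    (sub_ne_zero.mpr hxy)).comp_tendsto htendsto).congr_left fun z => ?_
  simp only [Function.comp_apply, jetPoly, map_smul, LinearMap.smul_apply, real_inner_smul_left,
    inner_radialHessian, sub_add_sub_cancel']
  ring

theorem weightedTrace_radialHessian_add_le {m : ℕ} {a : Fin (m + 1) → ℝ} (ha : ∀ i, 0 ≤ a i)
    {γ : ℝ} (hγ : γ ≤ 2) (hfirst : a 0 * (γ - 1) + weightHat a 0 ≤ 0) {e : Rn (m + 1)}
    (he : ‖e‖ = 1) {c : ℝ} (hc : 0 ≤ c) (k : ℝ)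
    (hX : (c • radialHessian γ e + k • 1).IsHermitian) :
    weightedTrace a hX ≤ k * ∑ i, a i := by
  have hform (v : Rn (m + 1)) :
      inner ℝ (Matrix.toEuclideanLin (c • radialHessian γ e + k • 1) v) v =
        c * (‖v‖ ^ 2 + (γ - 2) * inner ℝ e v ^ 2) + k * ‖v‖ ^ 2 := by
    simp [inner_add_left, real_inner_smul_left, inner_radialHessian]
  have htrace := weightedTrace_le hX ha (M := c + k) (fun v => ?_) he
    (q := c * (γ - 1) + k) (by rw [hform, real_inner_self_eq_norm_sq, he]; linarith)
  · calc weightedTrace a hX ≤ a 0 * (c * (γ - 1) + k) + weightHat a 0 * (c + k) := htrace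
      _ = c * (a 0 * (γ - 1) + weightHat a 0) + k * ∑ i, a i := by rw [weightHat]; ring
      _ ≤ k * ∑ i, a i := by linarith [mul_nonpos_of_nonneg_of_nonpos hc hfirst]
  · have := mul_nonneg (mul_nonneg hc (sub_nonneg.mpr hγ)) (sq_nonneg (inner ℝ e v))
    rw [hform]
    linarith

theorem exists_inSuperjet_mul_norm_rpow_sub_mul_norm_sq {m : ℕ} {a : Fin (m + 1) → ℝ}
    (ha : ∀ i, 0 ≤ a i) {γ : ℝ} (hγ₀ : 0 ≤ γ) (hγ₂ : γ ≤ 2)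
    (hfirst : a 0 * (γ - 1) + weightHat a 0 ≤ 0) {A : ℝ} (hA : 0 ≤ A) (k : ℝ)
    {O : Set (Rn (m + 1))} {x y : Rn (m + 1)} (hxy : x ≠ y) :
    ∃ (ξ : Rn (m + 1)) (X : Matrix (Fin (m + 1)) (Fin (m + 1)) ℝ) (hX : X.IsHermitian),
      InSuperjet O (fun z => A * ‖z - y‖ ^ γ - k / 2 * ‖z - y‖ ^ 2) x ξ X ∧
        weightedTrace a hX ≤ -k * ∑ i, a i := by
  have he : ‖‖x - y‖⁻¹ • (x - y)‖ = 1 := norm_smul_inv_norm (𝕜 := ℝ) (sub_ne_zero.mpr hxy)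
  have hradial := isHermitian_radialHessian γ (‖x - y‖⁻¹ • (x - y))
  have hjet := ((inSuperjet_norm_sub_rpow (O := O) γ hxy).const_mul hA).add
    (inSuperjet_mul_norm_sub_sq (-(k / 2)) y x)
  rw [smul_smul A, smul_smul A, show 2 * -(k / 2) = -k by ring] at hjet
  have hc : 0 ≤ A * (γ * ‖x - y‖ ^ (γ - 2)) := by positivity
  generalize A * (γ * ‖x - y‖ ^ (γ - 2)) = c at hjet hc
  have hX := (hradial.smul (.all c)).add (Matrix.isHermitian_one.smul (.all (-k)))
  exact ⟨_, _, hX, hjet.of_sub_le fun z _ => by linarith,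
    weightedTrace_radialHessian_add_le ha hγ₂ hfirst he hc (-k) hX⟩

/-! ### Enclosing spheres -/

section EnclosingSpheres

theorem inter_frontier_nonempty_of_isPreconnected {X : Type*} [TopologicalSpace X] {s t : Set X}
    (hs : IsPreconnected s) (ht : IsOpen t) (hst : (s ∩ t).Nonempty) (hs_sub : ¬ s ⊆ t) :
    (s ∩ frontier t).Nonempty := by
  by_contra hempty
  have hcover : s ∩ closure t ⊆ t := fun z hz => by
    by_contra hzt
    exact hempty ⟨z, hz.1, ht.frontier_eq ▸ ⟨hz.2, hzt⟩⟩
  exact hs_sub (hs.subset_of_closure_inter_subset ht hst (inter_comm s _ ▸ hcover))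

theorem convex_of_forall_frontier_exists_convex {E : Type*} [AddCommGroup E] [Module ℝ E]
    [TopologicalSpace E] [ContinuousAdd E] [ContinuousSMul ℝ E] {s : Set E} (hs : IsOpen s)
    (h : ∀ z ∈ frontier s, ∃ U : Set E, Convex ℝ U ∧ s ⊆ U ∧ z ∉ U) : Convex ℝ s := by
  refine convex_iff_segment_subset.mpr fun x hx y hy => ?_
  by_contra hsegment
  obtain ⟨z, hz, hzs⟩ := inter_frontier_nonempty_of_isPreconnected
    (convex_segment x y).isPreconnected hs ⟨x, left_mem_segment ℝ x y, hx⟩ hsegment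
  obtain ⟨U, hU, hsU, hzU⟩ := h z hzs
  exact hzU (hU.segment_subset (hsU hx) (hsU hy) hz)

theorem UniformExteriorSphere.convex {n : ℕ} {Ω : Set (Rn n)} {R : ℝ}
    (hS : UniformExteriorSphere Ω R) (hR : R ≠ 0) (hΩ : IsOpen Ω) : Convex ℝ Ω := by
  refine convex_of_forall_frontier_exists_convex hΩ fun z hz => ?_
  obtain ⟨c, hzc, hΩc⟩ := hS z hz
  refine ⟨Metric.ball c R, convex_ball c R, ?_, fun hzball => (Metric.mem_ball.mp hzball).ne hzc⟩
  rw [← interior_closedBall c hR]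
  exact interior_maximal (subset_closure.trans hΩc) hΩ

theorem norm_sub_sq_le_two_mul_inner_of_norm_sub_le {E : Type*} [SeminormedAddCommGroup E]
    [InnerProductSpace ℝ E] {c x z : E} (h : ‖z - c‖ ≤ ‖x - c‖) :
    ‖z - x‖ ^ 2 ≤ 2 * inner ℝ (x - c) (x - z) := by
  have hexpand : ‖z - c‖ ^ 2 = ‖x - c‖ ^ 2 - 2 * inner ℝ (x - c) (x - z) + ‖z - x‖ ^ 2 := by
    rw [norm_sub_rev z x, ← norm_sub_sq_real, sub_sub_sub_cancel_left]
  linarith [pow_le_pow_left₀ (norm_nonneg _) h 2]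

end EnclosingSpheres

/-! ### Barriers at the boundary -/

/-- First order expansions of `g` on `S`, with remainder of order `τ`: the common form in which
Hölder data (`τ = β`, with the zero vector) and `C^{1,β}` data (`τ = 1 + β`) enter the
estimates. -/
def HasUniformExpansionOn {n : ℕ} (τ : ℝ) (S : Set (Rn n)) (g : Rn n → ℝ) (N H : ℝ≥0) : Prop :=
  ∀ x ∈ S, ∃ V : Rn n, ‖V‖ ≤ N ∧ ∀ z ∈ S, |g z - g x - inner ℝ V (z - x)| ≤ H * ‖z - x‖ ^ τ

/-- The barrier at a point `x` of the sphere of center `x - p`. On the enclosed ball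
`2 ⟨p, x - z⟩ ≥ ‖z - x‖²`, so that there it dominates `⟨V, z - x⟩ + H ‖z - x‖ ^ (2σ)`; its Hessian
is at most `-k`. -/
def sphereBarrier {n : ℕ} (σ H k : ℝ) (p V x z : Rn n) : ℝ :=
  inner ℝ V (z - x) + H * (2 * inner ℝ p (x - z)) ^ σ +
    k / 2 * (2 * inner ℝ p (x - z) - ‖z - x‖ ^ 2)

section SphereBarrier

variable {n : ℕ} {σ H k : ℝ} {p V x z : Rn n}

theorem continuous_sphereBarrier (hσ : 0 ≤ σ) : Continuous (sphereBarrier σ H k p V x) := by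
  have hpow : Continuous fun z : Rn n => (2 * inner ℝ p (x - z)) ^ σ :=
    Continuous.rpow_const (by fun_prop) fun _ => .inr hσ
  exact ((by fun_prop : Continuous fun z => inner ℝ V (z - x)).add (hpow.const_mul H)).add
    (by fun_prop)

theorem le_sphereBarrier {τ : ℝ} (hτ : 0 ≤ τ) (hH : 0 ≤ H) (hk : 0 ≤ k)
    (hz : ‖z - x‖ ^ 2 ≤ 2 * inner ℝ p (x - z)) :
    inner ℝ V (z - x) + H * ‖z - x‖ ^ τ ≤ sphereBarrier (τ / 2) H k p V x z := by
  have hpow : ‖z - x‖ ^ τ ≤ (2 * inner ℝ p (x - z)) ^ (τ / 2) := by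
    rw [norm_rpow_eq_norm_sq_rpow_half]
    gcongr
  rw [sphereBarrier]
  linarith [mul_le_mul_of_nonneg_left hpow hH,
    mul_nonneg (div_nonneg hk zero_le_two) (sub_nonneg.mpr hz)]

theorem sphereBarrier_le {N : ℝ} (hσ : 0 ≤ σ) (hH : 0 ≤ H) (hk : 0 ≤ k) (hV : ‖V‖ ≤ N)
    (hz : 0 ≤ inner ℝ p (x - z)) :
    sphereBarrier σ H k p V x z ≤ N * ‖z - x‖ + H * (2 * ‖p‖ * ‖z - x‖) ^ σ +
      k * ‖p‖ * ‖z - x‖ - k / 2 * ‖z - x‖ ^ 2 := by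
  have hinner : inner ℝ p (x - z) ≤ ‖p‖ * ‖z - x‖ :=
    norm_sub_rev x z ▸ real_inner_le_norm p (x - z)
  calc sphereBarrier σ H k p V x z
      ≤ ‖V‖ * ‖z - x‖ + H * (2 * (‖p‖ * ‖z - x‖)) ^ σ +
        k / 2 * (2 * (‖p‖ * ‖z - x‖) - ‖z - x‖ ^ 2) := by
        rw [sphereBarrier]
        gcongr
        exact real_inner_le_norm V (z - x)
    _ ≤ N * ‖z - x‖ + H * (2 * (‖p‖ * ‖z - x‖)) ^ σ +
        k / 2 * (2 * (‖p‖ * ‖z - x‖) - ‖z - x‖ ^ 2) := by gcongr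
    _ = _ := by
        rw [← mul_assoc 2]
        ring

theorem exists_inSuperjet_sphereBarrier {O : Set (Rn n)} (hσ₀ : 0 ≤ σ) (hσ₁ : σ ≤ 1) (hH : 0 ≤ H)
    (hO : ∀ w ∈ O, 0 ≤ inner ℝ p (x - w)) (hz : 0 < inner ℝ p (x - z)) :
    ∃ ξ, InSuperjet O (sphereBarrier σ H k p V x) z ξ (-k • 1) := by
  have haffine : InSuperjet O (fun w => 2 * inner ℝ p (x - w)) z (-(2 : ℝ) • p) 0 :=
    (inSuperjet_inner _ z).of_sub_le fun w _ => by
      simp only [real_inner_smul_left, inner_sub_right]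
      linarith
  have hpow := (haffine.rpow hσ₀ hσ₁ (by linarith) fun w hw => by linarith [hO w hw]).const_mul hH
  have hsq := inSuperjet_mul_norm_sub_sq (O := O) (-(k / 2)) x z
  have hsum := ((inSuperjet_inner (O := O) (V - k • p) z).add hpow).add hsq
  have hmatrix : 2 * -(k / 2) = -k := by ring
  simp only [smul_zero, add_zero, zero_add, hmatrix] at hsum
  refine ⟨_, hsum.of_sub_le fun w _ => ?_⟩
  simp only [sphereBarrier, inner_sub_right, inner_sub_left, real_inner_smul_left]
  linarith

end SphereBarrier

/-! ### Hölder estimates for solutions -/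

section Subsolutions

variable {n : ℕ} {a : Fin n → ℝ} {Ω : Set (Rn n)} {f u : Rn n → ℝ} {R τ γ k : ℝ} {N H : ℝ≥0}

theorem HasUniformExpansionOn.neg {S : Set (Rn n)} (h : HasUniformExpansionOn τ S u N H) :
    HasUniformExpansionOn τ S (fun x => -u x) N H := by
  intro x hx
  obtain ⟨V, hV, hexp⟩ := h x hx
  refine ⟨-V, by rwa [norm_neg], fun z hz => ?_⟩
  rw [inner_neg_left, neg_sub_neg, sub_neg_eq_add, ← neg_sub (u z), neg_add_eq_sub, abs_sub_comm]
  exact hexp z hz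

theorem HasUniformExpansionOn.congr {S : Set (Rn n)} {g : Rn n → ℝ}
    (h : HasUniformExpansionOn τ S g N H) (hu : ∀ x ∈ S, u x = g x) :
    HasUniformExpansionOn τ S u N H := fun x hx => by
  obtain ⟨V, hV, hexp⟩ := h x hx
  exact ⟨V, hV, fun z hz => by rw [hu z hz, hu x hx]; exact hexp z hz⟩

theorem IsViscositySubsolution.sub_le_at_frontier (h : IsViscositySubsolution a Ω f u)
    (hΩ : IsOpen Ω) (hb : Bornology.IsBounded Ω) (hu : ContinuousOn u (closure Ω))
    (hS : UniformExteriorSphere Ω R) (hk : 0 ≤ k) (hf : ∀ x ∈ Ω, -k * ∑ i, a i < f x)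
    (hτ₀ : 0 ≤ τ) (hτ₂ : τ ≤ 2) (hg : HasUniformExpansionOn τ (frontier Ω) u N H)
    {x y : Rn n} (hx : x ∈ frontier Ω) (hy : y ∈ closure Ω) :
    u y - u x ≤ N * ‖y - x‖ + H * (2 * R * ‖y - x‖) ^ (τ / 2) + k * R * ‖y - x‖ -
      k / 2 * ‖y - x‖ ^ 2 := by
  obtain ⟨c, hxc, hΩc⟩ := hS x hx
  obtain ⟨V, hV, hexp⟩ := hg x hx
  rw [mem_sphere_iff_norm] at hxc
  have hball {z : Rn n} (hz : z ∈ closure Ω) : ‖z - x‖ ^ 2 ≤ 2 * inner ℝ (x - c) (x - z) :=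
    norm_sub_sq_le_two_mul_inner_of_norm_sub_le (hxc ▸ mem_closedBall_iff_norm.mp (hΩc hz))
  have hball₀ {z : Rn n} (hz : z ∈ closure Ω) : 0 ≤ inner ℝ (x - c) (x - z) := by
    linarith [hball hz, sq_nonneg ‖z - x‖]
  have hbarrier : u y - u x ≤ sphereBarrier (τ / 2) H k (x - c) V x y := by
    refine h.sub_le_of_forall_strict (u x) hb.isCompact_closure subset_closure hu
      (continuous_sphereBarrier (by positivity)).continuousOn (fun z hz => ?_) hy
    by_cases hzΩ : z ∈ Ω
    · have hzx : z ≠ x := by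
        rintro rfl
        exact (hΩ.frontier_eq ▸ hx).2 hzΩ
      have hpos : 0 < inner ℝ (x - c) (x - z) := by
        linarith [hball hz, pow_pos (norm_sub_pos_iff.mpr hzx) 2]
      obtain ⟨ξ, hξ⟩ := exists_inSuperjet_sphereBarrier (O := Ω) (σ := τ / 2) (k := k) (V := V)
        (by positivity) (by linarith) H.coe_nonneg (fun w hw => hball₀ (subset_closure hw)) hpos
      refine .inr ⟨hzΩ, ξ, -k • 1, Matrix.isHermitian_one.smul (.all (-k)), hξ, ?_⟩
      exact (weightedTrace_of_eq_smul_one a _ rfl).trans_lt (hf z hzΩ)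
    · have hle := le_sphereBarrier (V := V) hτ₀ H.coe_nonneg hk (hball hz)
      exact .inl (by linarith [le_of_abs_le (hexp z (hΩ.frontier_eq ▸ ⟨hz, hzΩ⟩))])
  have hupper := sphereBarrier_le (σ := τ / 2) (by positivity) H.coe_nonneg hk hV (hball₀ hy)
  exact hbarrier.trans (hxc ▸ hupper)

theorem rpow_le_mul_rpow_of_le {r M γ σ : ℝ} (hr : 0 ≤ r) (hrM : r ≤ M) (hM : 1 ≤ M)
    (hγ : 0 ≤ γ) (hγσ : γ ≤ σ) (hσ : σ ≤ 1) : r ^ σ ≤ M * r ^ γ := by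
  rcases le_total r 1 with hr₁ | hr₁
  · calc r ^ σ ≤ r ^ γ := Real.rpow_le_rpow_of_exponent_ge_of_imp hr hr₁ hγσ fun _ _ => by linarith
      _ ≤ M * r ^ γ := le_mul_of_one_le_left (by positivity) hM
  · calc r ^ σ = r ^ (σ - γ) * r ^ γ := by rw [← Real.rpow_add (by linarith), sub_add_cancel]
      _ ≤ r ^ (1 : ℝ) * r ^ γ := by gcongr; linarith
      _ ≤ M * r ^ γ := by rw [Real.rpow_one]; gcongr

theorem barrier_bound_le_mul_rpow {r N H : ℝ} (hr : 0 ≤ r) (hrR : r ≤ 2 * R) (hN : 0 ≤ N)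
    (hH : 0 ≤ H) (hk : 0 ≤ k) (hγ : 0 ≤ γ) {σ : ℝ} (hγσ : γ ≤ σ) (hσ : σ ≤ 1) :
    N * r + H * (2 * R * r) ^ σ + k * R * r ≤ (1 + 2 * R) ^ 2 * (N + H + k) * r ^ γ := by
  have hM : 1 ≤ 1 + 2 * R := by linarith
  have hlinear : r ≤ (1 + 2 * R) * r ^ γ := by
    simpa using rpow_le_mul_rpow_of_le hr (by linarith) hM hγ (hγσ.trans hσ) le_rfl
  have hradius : (2 * R) ^ σ ≤ 1 + 2 * R := by
    simpa using rpow_le_mul_rpow_of_le (by linarith : 0 ≤ 2 * R) (by linarith) hM le_rfl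
      (hγ.trans hγσ) hσ
  have hpow : r ^ σ ≤ (1 + 2 * R) * r ^ γ :=
    rpow_le_mul_rpow_of_le hr (by linarith) hM hγ hγσ hσ
  have hR : 0 ≤ R := by linarith
  calc N * r + H * (2 * R * r) ^ σ + k * R * r
      = N * r + H * ((2 * R) ^ σ * r ^ σ) + k * R * r := by
        rw [Real.mul_rpow (by positivity) hr]
    _ ≤ (1 + 2 * R) * N * ((1 + 2 * R) * r ^ γ) +
        H * ((1 + 2 * R) * ((1 + 2 * R) * r ^ γ)) +
        k * (1 + 2 * R) * ((1 + 2 * R) * r ^ γ) := by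
        gcongr
        · exact le_mul_of_one_le_left hN hM
        · linarith
    _ = (1 + 2 * R) ^ 2 * (N + H + k) * r ^ γ := by ring

end Subsolutions

section Solutions

variable {m : ℕ} {a : Fin (m + 1) → ℝ} {Ω : Set (Rn (m + 1))} {f g u : Rn (m + 1) → ℝ}
  {R τ γ k : ℝ} {N H : ℝ≥0}

theorem IsViscositySubsolution.sub_le_of_frontier (h : IsViscositySubsolution a Ω f u)
    (ha : ∀ i, 0 ≤ a i) (hΩ : IsOpen Ω) (hb : Bornology.IsBounded Ω)
    (hu : ContinuousOn u (closure Ω)) (hf : ∀ x ∈ Ω, -k * ∑ i, a i < f x)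
    (hγ₀ : 0 ≤ γ) (hγ₂ : γ ≤ 2) (hfirst : a 0 * (γ - 1) + weightHat a 0 ≤ 0) {A : ℝ} (hA : 0 ≤ A)
    {y : Rn (m + 1)} (hbd : ∀ z ∈ frontier Ω, u z - u y ≤ A * ‖z - y‖ ^ γ - k / 2 * ‖z - y‖ ^ 2)
    {x : Rn (m + 1)} (hx : x ∈ closure Ω) :
    u x - u y ≤ A * ‖x - y‖ ^ γ - k / 2 * ‖x - y‖ ^ 2 := by
  have hpow : Continuous fun z : Rn (m + 1) => ‖z - y‖ ^ γ :=
    Continuous.rpow_const (by fun_prop) fun _ => .inr hγ₀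
  have hcont : Continuous fun z : Rn (m + 1) => A * ‖z - y‖ ^ γ - k / 2 * ‖z - y‖ ^ 2 :=
    (hpow.const_mul A).sub (by fun_prop)
  refine h.sub_le_of_forall_strict (u y) hb.isCompact_closure subset_closure hu hcont.continuousOn
    (fun z hz => ?_) hx
  by_cases hzΩ : z ∈ Ω
  · rcases eq_or_ne z y with rfl | hzy
    · have hnonneg : 0 ≤ A * (0 : ℝ) ^ γ := by positivity
      exact .inl (by simpa using hnonneg)
    · obtain ⟨ξ, X, hX, hjet, htrace⟩ :=
        exists_inSuperjet_mul_norm_rpow_sub_mul_norm_sq (O := Ω) ha hγ₀ hγ₂ hfirst hA k hzy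
      exact .inr ⟨hzΩ, ξ, X, hX, hjet, htrace.trans_lt (hf z hzΩ)⟩
  · exact .inl (hbd z (hΩ.frontier_eq ▸ ⟨hz, hzΩ⟩))

/-- The constant of the Hölder estimates, for weights of sum `s`. -/
def holderConstant (R s : ℝ) : ℝ≥0 :=
  Real.toNNReal ((1 + 2 * R) ^ 2 * (1 + |s|⁻¹))

theorem holderConstant_pos {s : ℝ} (hR : 0 < R) : 0 < holderConstant R s := by
  rw [holderConstant, Real.toNNReal_pos]
  positivity

theorem IsDirichletSolution.sub_le_of_first_weight (h : IsDirichletSolution a Ω f g u)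
    (ha : ∀ i, 0 ≤ a i) (hS : UniformExteriorSphere Ω R) (hk : 0 ≤ k)
    (hf : ∀ x ∈ Ω, |f x| < k * ∑ i, a i) (hfirst : a 0 * (γ - 1) + weightHat a 0 ≤ 0)
    (hγ : 0 ≤ γ) (hγτ : γ ≤ τ / 2) (hτ : τ ≤ 2) (hg : HasUniformExpansionOn τ (frontier Ω) g N H)
    {x y : Rn (m + 1)} (hx : x ∈ closure Ω) (hy : y ∈ closure Ω) :
    u x - u y ≤ (1 + 2 * R) ^ 2 * (N + H + k) * ‖x - y‖ ^ γ := by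
  have hlower : ∀ z ∈ frontier Ω, u z - u y ≤
      (1 + 2 * R) ^ 2 * (N + H + k) * ‖z - y‖ ^ γ - k / 2 * ‖z - y‖ ^ 2 := fun z hz => by
    have hbarrier := h.neg.subsolution.sub_le_at_frontier h.isOpen h.isBounded h.neg.continuousOn
      hS hk (fun w hw => ?_) (by linarith) hτ (hg.congr h.boundary).neg hz hy
    · obtain ⟨c, hzc, hΩc⟩ := hS z hz
      have hdiam : ‖y - z‖ ≤ 2 * R := by
        have hyc := Metric.mem_closedBall.mp (hΩc hy)
        rw [← dist_eq_norm]
        linarith [dist_triangle_right y z c, Metric.mem_sphere.mp hzc]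
      have hbound := barrier_bound_le_mul_rpow (norm_nonneg _) hdiam N.coe_nonneg H.coe_nonneg hk
        hγ hγτ (by linarith)
      rw [norm_sub_rev z y]
      linarith
    · rw [sum_comp_rev]
      linarith [lt_of_abs_lt (hf w hw)]
  have hle := h.subsolution.sub_le_of_frontier ha h.isOpen h.isBounded h.continuousOn
    (fun z hz => by linarith [neg_lt_of_abs_lt (hf z hz)]) hγ (by linarith) hfirst
    (by positivity) hlower hx
  exact hle.trans (sub_le_self _ (by positivity))

theorem IsDirichletSolution.abs_sub_le_of_first_weight (h : IsDirichletSolution a Ω f g u)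
    (ha : ∀ i, 0 ≤ a i) (hS : UniformExteriorSphere Ω R) (hk : 0 ≤ k)
    (hf : ∀ x ∈ Ω, |f x| < k * ∑ i, a i) (hfirst : a 0 * (γ - 1) + weightHat a 0 ≤ 0)
    (hγ : 0 ≤ γ) (hγτ : γ ≤ τ / 2) (hτ : τ ≤ 2) (hg : HasUniformExpansionOn τ (frontier Ω) g N H)
    {x y : Rn (m + 1)} (hx : x ∈ closure Ω) (hy : y ∈ closure Ω) :
    |u x - u y| ≤ (1 + 2 * R) ^ 2 * (N + H + k) * ‖x - y‖ ^ γ := by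
  refine abs_sub_le_iff.mpr ⟨h.sub_le_of_first_weight ha hS hk hf hfirst hγ hγτ hτ hg hx hy, ?_⟩
  rw [norm_sub_rev]
  exact h.sub_le_of_first_weight ha hS hk hf hfirst hγ hγτ hτ hg hy hx

theorem IsDirichletSolution.abs_sub_le_of_abs_rhs_lt (h : IsDirichletSolution a Ω f g u)
    (ha : IsWeight a) (has : IsAsymmetric a) (hS : UniformExteriorSphere Ω R) (hk : 0 ≤ k)
    (hf : ∀ x ∈ Ω, |f x| < k * ∑ i, a i) (hγ : 0 ≤ γ) (hγa : γ ≤ asymmetryExponent a)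
    (hγτ : γ ≤ τ / 2) (hτ : τ ≤ 2) (hg : HasUniformExpansionOn τ (frontier Ω) g N H)
    {x y : Rn (m + 1)} (hx : x ∈ closure Ω) (hy : y ∈ closure Ω) :
    |u x - u y| ≤ (1 + 2 * R) ^ 2 * (N + H + k) * ‖x - y‖ ^ γ := by
  rcases (le_asymmetryExponent_iff ha has).mp hγa with ⟨-, hfirst⟩ | ⟨-, hlast⟩
  · exact h.abs_sub_le_of_first_weight ha.1 hS hk hf hfirst hγ hγτ hτ hg hx hy
  · have hneg := h.neg.abs_sub_le_of_first_weight (fun i => ha.1 _) hS hk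
      (by simpa only [abs_neg, sum_comp_rev] using hf)
      (by rwa [weightHat_comp_rev, Function.comp_apply, Fin.rev_zero]) hγ hγτ hτ hg.neg hx hy
    rwa [neg_sub_neg, abs_sub_comm] at hneg

theorem IsDirichletSolution.abs_sub_le (h : IsDirichletSolution a Ω f g u)
    (ha : IsWeight a) (has : IsAsymmetric a) (hS : UniformExteriorSphere Ω R) {F : ℝ≥0}
    (hf : ∀ x ∈ Ω, |f x| ≤ F) (hγ : 0 ≤ γ) (hγa : γ ≤ asymmetryExponent a)
    (hγτ : γ ≤ τ / 2) (hτ : τ ≤ 2) (hg : HasUniformExpansionOn τ (frontier Ω) g N H)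
    {x y : Rn (m + 1)} (hx : x ∈ closure Ω) (hy : y ∈ closure Ω) :
    |u x - u y| ≤ holderConstant R (∑ i, a i) * (N + H + F) * ‖x - y‖ ^ γ := by
  have hs := ha.sum_pos
  have hlimit : |u x - u y| ≤
      (1 + 2 * R) ^ 2 * (N + H + F / ∑ i, a i) * ‖x - y‖ ^ γ := by
    refine le_on_closure (s := Ioi (F / ∑ i, a i))
      (g := fun k => (1 + 2 * R) ^ 2 * (N + H + k) * ‖x - y‖ ^ γ) (fun k hk => ?_)
      continuousOn_const (by fun_prop) (closure_Ioi (F / ∑ i, a i) ▸ self_mem_Ici)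
    refine h.abs_sub_le_of_abs_rhs_lt ha has hS ?_ (fun z hz => ?_) hγ hγa hγτ hτ hg hx hy
    · exact (by positivity : 0 ≤ F / ∑ i, a i).trans hk.le
    · exact (hf z hz).trans_lt ((div_lt_iff₀ hs).mp hk)
  have hdata : N + H + F / ∑ i, a i ≤ (1 + (∑ i, a i)⁻¹) * (N + H + F) := by
    have hcross : 0 ≤ (∑ i, a i)⁻¹ * (N + H) := by positivity
    rw [div_eq_mul_inv]
    linarith [F.coe_nonneg]
  calc |u x - u y|
      ≤ (1 + 2 * R) ^ 2 * ((1 + (∑ i, a i)⁻¹) * (N + H + F)) * ‖x - y‖ ^ γ :=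
        hlimit.trans (by gcongr)
    _ = holderConstant R (∑ i, a i) * (N + H + F) * ‖x - y‖ ^ γ := by
        rw [holderConstant, Real.coe_toNNReal _ (by positivity), abs_of_pos hs, ← mul_assoc (_ ^ 2)]

end Solutions

/-! ### Hölder norms -/

section Norms

variable {n : ℕ}

theorem enorm_le_linftyNorm {Ω : Set (Rn n)} {f : Rn n → ℝ} (hΩ : IsOpen Ω)
    (hf : ContinuousOn f Ω) {x : Rn n} (hx : x ∈ Ω) : ‖f x‖ₑ ≤ linftyNorm Ω f := by
  have hae : ∀ᵐ z ∂volume.restrict Ω, ‖f z‖ₑ ≤ linftyNorm Ω f := by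
    rw [linftyNorm, eLpNorm_exponent_top]
    exact ae_le_eLpNormEssSup
  rw [ae_restrict_iff' hΩ.measurableSet, ae_iff] at hae
  by_contra! h
  have hopen : IsOpen (Ω ∩ (fun z => ‖f z‖ₑ) ⁻¹' Ioi (linftyNorm Ω f)) :=
    (continuous_enorm.comp_continuousOn hf).isOpen_inter_preimage hΩ isOpen_Ioi
  refine (hopen.measure_pos volume ⟨x, hx, h⟩).ne' (measure_mono_null (fun z hz => ?_) hae)
  exact fun hle => (hle hz.1).not_gt hz.2

theorem linftyNorm_lt_top {Ω : Set (Rn n)} {f : Rn n → ℝ} (hΩ : MeasurableSet Ω)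
    (hf : ∃ M : ℝ, ∀ x ∈ Ω, |f x| ≤ M) : linftyNorm Ω f < ∞ := by
  obtain ⟨M, hM⟩ := hf
  rw [linftyNorm, eLpNorm_exponent_top]
  exact eLpNormEssSup_lt_top_of_ae_bound ((ae_restrict_iff' hΩ).mpr (.of_forall hM))

theorem supNormOn_lt_top {F : Type} [NormedAddCommGroup F] {D : Set (Rn n)} {h : Rn n → F}
    (hD : IsCompact D) (hh : ContinuousOn h D) : supNormOn D h < ∞ := by
  obtain ⟨M, hM⟩ := hD.exists_bound_of_continuousOn hh
  refine (iSup₂_le fun x hx => ?_).trans_lt (ENNReal.ofReal_lt_top (r := M))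
  rw [← ofReal_norm]
  exact ENNReal.ofReal_le_ofReal (hM x hx)

theorem norm_le_supNormOn {F : Type} [NormedAddCommGroup F] {D : Set (Rn n)} {h : Rn n → F}
    (hh : supNormOn D h ≠ ∞) {x : Rn n} (hx : x ∈ D) : ‖h x‖ ≤ (supNormOn D h).toNNReal := by
  rw [← toReal_enorm]
  exact ENNReal.toReal_mono hh (le_iSup₂ (f := fun x (_ : x ∈ D) => ‖h x‖ₑ) x hx)

theorem norm_sub_le_holderSeminorm {F : Type} [NormedAddCommGroup F] {β : ℝ} (hβ : 0 ≤ β)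
    {D : Set (Rn n)} {h : Rn n → F} (hh : holderSeminorm β D h ≠ ∞) {x y : Rn n} (hx : x ∈ D)
    (hy : y ∈ D) : ‖h x - h y‖ ≤ (holderSeminorm β D h).toNNReal * ‖x - y‖ ^ β := by
  have hdist := (eHolderNorm_ne_top.mp hh).holderWith.dist_le (⟨x, hx⟩ : D) ⟨y, hy⟩
  rwa [dist_eq_norm, Subtype.dist_eq, dist_eq_norm, Real.coe_toNNReal β hβ] at hdist

theorem holderSeminorm_le {F : Type} [NormedAddCommGroup F] {γ : ℝ} (hγ : 0 ≤ γ) {C : ℝ≥0}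
    {D : Set (Rn n)} {h : Rn n → F} (hh : ∀ x ∈ D, ∀ y ∈ D, ‖h x - h y‖ ≤ C * ‖x - y‖ ^ γ) :
    holderSeminorm γ D h ≤ C := by
  refine HolderWith.eHolderNorm_le fun x y => ?_
  rw [edist_dist, edist_dist, Subtype.dist_eq, dist_eq_norm, dist_eq_norm,
    Real.coe_toNNReal γ hγ, ENNReal.ofReal_rpow_of_nonneg (norm_nonneg _) hγ,
    ← ENNReal.ofReal_coe_nnreal, ← ENNReal.ofReal_mul C.coe_nonneg]
  exact ENNReal.ofReal_le_ofReal (hh x x.2 y y.2)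

theorem holderOn_of_norm_sub_le {D : Set (Rn n)} {h : Rn n → ℝ} {γ : ℝ} (hγ : 0 ≤ γ) {C : ℝ≥0}
    (hD : IsCompact D) (hcont : ContinuousOn h D)
    (hh : ∀ x ∈ D, ∀ y ∈ D, ‖h x - h y‖ ≤ C * ‖x - y‖ ^ γ) : HolderOn γ D h :=
  ⟨hcont, ENNReal.add_lt_top.mpr
    ⟨supNormOn_lt_top hD hcont, (holderSeminorm_le hγ hh).trans_lt ENNReal.coe_lt_top⟩⟩

end Norms

/-! ### Expansions of the boundary data -/

section Expansions

variable {n : ℕ} {Ω : Set (Rn n)} {g G : Rn n → ℝ} {V : Rn n → Rn n} {β : ℝ}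

theorem HolderOn.hasUniformExpansionOn {S : Set (Rn n)} (hβ : 0 ≤ β) (hg : HolderOn β S g) :
    HasUniformExpansionOn β S g 0 (holderSeminorm β S g).toNNReal := fun x hx =>
  ⟨0, by simp, fun z hz => by
    simpa using norm_sub_le_holderSeminorm hβ (ENNReal.add_lt_top.mp hg.2).2.ne hz hx⟩

theorem norm_sub_sub_inner_le_of_hasGradientAt {E : Type*} [NormedAddCommGroup E]
    [InnerProductSpace ℝ E] [CompleteSpace E] {s : Set E} {G : E → ℝ} {V : E → E} {H : ℝ}
    (hs : Convex ℝ s) (hG : ∀ x ∈ s, HasGradientAt G (V x) x) (hβ : 0 ≤ β) (hH : 0 ≤ H)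
    (hV : ∀ x ∈ s, ∀ y ∈ s, ‖V x - V y‖ ≤ H * ‖x - y‖ ^ β) {x z : E} (hx : x ∈ s)
    (hz : z ∈ s) : ‖G z - G x - inner ℝ (V x) (z - x)‖ ≤ H * ‖z - x‖ ^ (1 + β) := by
  have hseg := hs.segment_subset hx hz
  have hmean := (convex_segment x z).norm_image_sub_le_of_norm_hasFDerivWithin_le'
    (f' := fun w => toDual ℝ E (V w)) (φ := toDual ℝ E (V x)) (C := H * ‖z - x‖ ^ β)
    (fun w hw => (hG w (hseg hw)).hasFDerivAt.hasFDerivWithinAt)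
    (fun w hw => ?_) (left_mem_segment ℝ x z) (right_mem_segment ℝ x z)
  · rwa [toDual_apply_apply, mul_assoc, mul_comm (_ ^ β), ← Real.rpow_one_add' (norm_nonneg _)
      (by positivity)] at hmean
  · rw [← map_sub, LinearIsometryEquiv.norm_map]
    refine (hV w (hseg hw) x hx).trans ?_
    gcongr
    exact norm_sub_le_of_mem_segment hw

theorem IsC1Extension.norm_sub_sub_inner_le (hG : IsC1Extension Ω g G V) (hΩ : Convex ℝ Ω)
    (hβ : 0 ≤ β) {H : ℝ} (hH : 0 ≤ H) (hV : ∀ x ∈ Ω, ∀ y ∈ Ω, ‖V x - V y‖ ≤ H * ‖x - y‖ ^ β)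
    {x z : Rn n} (hx : x ∈ closure Ω) (hz : z ∈ closure Ω) :
    ‖G z - G x - inner ℝ (V x) (z - x)‖ ≤ H * ‖z - x‖ ^ (1 + β) := by
  have hfst : MapsTo Prod.fst (closure Ω ×ˢ closure Ω) (closure Ω) := fun p hp => hp.1
  have hsnd : MapsTo Prod.snd (closure Ω ×ˢ closure Ω) (closure Ω) := fun p hp => hp.2
  have hremainder : ContinuousOn (fun p : Rn n × Rn n =>
      ‖G p.2 - G p.1 - inner ℝ (V p.1) (p.2 - p.1)‖) (closure Ω ×ˢ closure Ω) :=
    (((hG.continuousOn.comp continuousOn_snd hsnd).sub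
      (hG.continuousOn.comp continuousOn_fst hfst)).sub
      ((hG.continuousOn_grad.comp continuousOn_fst hfst).inner
        (continuousOn_snd.sub continuousOn_fst))).norm
  have hpow : Continuous fun p : Rn n × Rn n => ‖p.2 - p.1‖ ^ (1 + β) :=
    Continuous.rpow_const (by fun_prop) fun _ => .inr (by positivity)
  rw [← closure_prod_eq] at hremainder
  refine le_on_closure (x := (x, z)) (fun p hp => ?_) hremainder
    (hpow.const_mul H).continuousOn ?_
  · exact norm_sub_sub_inner_le_of_hasGradientAt hΩ hG.hasGradientAt hβ hH hV hp.1 hp.2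
  · rw [closure_prod_eq]
    exact ⟨hx, hz⟩

theorem IsC1Extension.hasUniformExpansionOn (hG : IsC1Extension Ω g G V) (hΩ : Convex ℝ Ω)
    (hβ : 0 ≤ β) (hsup : supNormOn (closure Ω) V ≠ ∞)
    (hholder : holderSeminorm β (closure Ω) V ≠ ∞) :
    HasUniformExpansionOn (1 + β) (frontier Ω) g (supNormOn (closure Ω) V).toNNReal
      (holderSeminorm β (closure Ω) V).toNNReal := by
  refine fun x hx => ⟨V x, norm_le_supNormOn hsup (frontier_subset_closure hx), fun z hz => ?_⟩
  rw [← hG.eq_boundary z hz, ← hG.eq_boundary x hx]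
  exact hG.norm_sub_sub_inner_le hΩ hβ NNReal.zero_le_coe (fun v hv w hw =>
    norm_sub_le_holderSeminorm hβ hholder (subset_closure hv) (subset_closure hw))
    (frontier_subset_closure hx) (frontier_subset_closure hz)

end Expansions

/-! ### Estimates in terms of the boundary norms -/

section Estimates

variable {m : ℕ} {a : Fin (m + 1) → ℝ} {Ω : Set (Rn (m + 1))} {f g u : Rn (m + 1) → ℝ}
  {R β γ : ℝ}

theorem IsDirichletSolution.holderOn_of_hasUniformExpansionOn (h : IsDirichletSolution a Ω f g u)
    (ha : IsWeight a) (has : IsAsymmetric a) (hS : UniformExteriorSphere Ω R) (hγ : 0 ≤ γ)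
    (hγa : γ ≤ asymmetryExponent a) {τ : ℝ} (hγτ : γ ≤ τ / 2) (hτ : τ ≤ 2) {N H : ℝ≥0}
    (hg : HasUniformExpansionOn τ (frontier Ω) g N H) :
    HolderOn γ (closure Ω) u ∧
      holderSeminorm γ Ω u ≤ holderConstant R (∑ i, a i) * (N + H + linftyNorm Ω f) := by
  have hfin := (linftyNorm_lt_top h.isOpen.measurableSet h.bounded_rhs).ne
  lift linftyNorm Ω f to ℝ≥0 using hfin with F hF
  have hf : ∀ x ∈ Ω, |f x| ≤ F := fun x hx => by
    have hle := hF ▸ enorm_le_linftyNorm h.isOpen h.continuousOn_rhs hx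
    exact_mod_cast hle
  have hu : ∀ x ∈ closure Ω, ∀ y ∈ closure Ω, ‖u x - u y‖ ≤
      (holderConstant R (∑ i, a i) * (N + H + F) : ℝ≥0) * ‖x - y‖ ^ γ := fun x hx y hy => by
    exact_mod_cast h.abs_sub_le ha has hS hf hγ hγa hγτ hτ hg hx hy
  refine ⟨holderOn_of_norm_sub_le hγ h.isBounded.isCompact_closure h.continuousOn hu, ?_⟩
  exact_mod_cast holderSeminorm_le hγ fun x hx y hy =>
    hu x (subset_closure hx) y (subset_closure hy)

theorem IsDirichletSolution.holderOn_of_holderOn (h : IsDirichletSolution a Ω f g u)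
    (ha : IsWeight a) (has : IsAsymmetric a) (hS : UniformExteriorSphere Ω R) (hγ : 0 ≤ γ)
    (hγa : γ ≤ asymmetryExponent a) (hγβ : γ ≤ β / 2) (hβ : β ≤ 2)
    (hg : HolderOn β (frontier Ω) g) :
    HolderOn γ (closure Ω) u ∧ holderSeminorm γ Ω u ≤
      holderConstant R (∑ i, a i) * (holderNorm β (frontier Ω) g + linftyNorm Ω f) := by
  obtain ⟨hu, hle⟩ := h.holderOn_of_hasUniformExpansionOn ha has hS hγ hγa hγβ hβ
    (hg.hasUniformExpansionOn (by linarith))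
  refine ⟨hu, hle.trans ?_⟩
  rw [ENNReal.coe_zero, zero_add, ENNReal.coe_toNNReal (ENNReal.add_lt_top.mp hg.2).2.ne]
  gcongr
  exact le_add_self

theorem IsDirichletSolution.holderOn_of_isC1Extension (h : IsDirichletSolution a Ω f g u)
    (ha : IsWeight a) (has : IsAsymmetric a) (hR : R ≠ 0) (hS : UniformExteriorSphere Ω R)
    (hγ : 0 ≤ γ) (hγa : γ ≤ asymmetryExponent a) (hβ₀ : 0 ≤ β) (hβ₁ : β ≤ 1)
    (hγβ : γ ≤ (1 + β) / 2) {G : Rn (m + 1) → ℝ} {V : Rn (m + 1) → Rn (m + 1)}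
    (hG : IsC1Extension Ω g G V) (hsup : supNormOn (closure Ω) V ≠ ∞)
    (hholder : holderSeminorm β (closure Ω) V ≠ ∞) :
    HolderOn γ (closure Ω) u ∧ holderSeminorm γ Ω u ≤ holderConstant R (∑ i, a i) *
      (supNormOn (closure Ω) V + holderSeminorm β (closure Ω) V + linftyNorm Ω f) := by
  simpa only [ENNReal.coe_toNNReal hsup, ENNReal.coe_toNNReal hholder] using
    h.holderOn_of_hasUniformExpansionOn ha has hS hγ hγa hγβ (by linarith)
      (hG.hasUniformExpansionOn (hS.convex hR h.isOpen) hβ₀ hsup hholder)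

theorem IsDirichletSolution.holderOn_of_boundaryC1HolderNorm_lt_top
    (h : IsDirichletSolution a Ω f g u) (ha : IsWeight a) (has : IsAsymmetric a) (hR : R ≠ 0)
    (hS : UniformExteriorSphere Ω R) (hγ : 0 ≤ γ) (hγa : γ ≤ asymmetryExponent a) (hβ₀ : 0 ≤ β)
    (hβ₁ : β ≤ 1) (hγβ : γ ≤ (1 + β) / 2) (hg : boundaryC1HolderNorm β Ω g < ∞) :
    HolderOn γ (closure Ω) u ∧ holderSeminorm γ Ω u ≤
      holderConstant R (∑ i, a i) * (boundaryC1HolderNorm β Ω g + linftyNorm Ω f) := by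
  have hextension : ∀ M > boundaryC1HolderNorm β Ω g,
      HolderOn γ (closure Ω) u ∧ holderSeminorm γ Ω u ≤
        holderConstant R (∑ i, a i) * (M + linftyNorm Ω f) := fun M hM => by
    simp only [boundaryC1HolderNorm, iInf_lt_iff] at hM
    obtain ⟨G, V, hG, hlt⟩ := hM
    obtain ⟨hsupG, hholder⟩ := ENNReal.add_lt_top.mp (hlt.trans_le le_top)
    obtain ⟨hu, hle⟩ := h.holderOn_of_isC1Extension ha has hR hS hγ hγa hβ₀ hβ₁ hγβ hG
      (ENNReal.add_lt_top.mp hsupG).2.ne hholder.ne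
    refine ⟨hu, hle.trans ?_⟩
    gcongr
    exact (add_le_add_left le_add_self _).trans hlt.le
  refine ⟨(hextension ∞ hg).1, ?_⟩
  refine le_on_closure (s := Ioi (boundaryC1HolderNorm β Ω g)) (f := fun _ => holderSeminorm γ Ω u)
    (g := fun M => holderConstant R (∑ i, a i) * (M + linftyNorm Ω f))
    (fun M hM => (hextension M hM).2) continuousOn_const ?_ ?_
  · exact ((ENNReal.continuous_const_mul ENNReal.coe_ne_top).comp (by fun_prop)).continuousOn
  · rw [closure_Ioi' ⟨∞, hg⟩]
    exact self_mem_Ici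

end Estimates

end

theorem mainTheorem8_general (m : ℕ) (aMean : ℝ) {R : ℝ} (hR : 0 < R) :
    ∃ C : ℝ≥0, 0 < C ∧
      ∀ (a : Fin (m + 1) → ℝ) (Ω : Set (Rn (m + 1))) (f g u : Rn (m + 1) → ℝ),
        IsWeight a → IsAsymmetric a → weightMean a = aMean →
        IsDirichletSolution a Ω f g u → UniformExteriorSphere Ω R →
        (∀ β γ : ℝ, 0 ≤ γ → γ ≤ asymmetryExponent a → β ≤ 1 → γ ≤ β / 2 →
          HolderOn β (frontier Ω) g →
          HolderOn γ (closure Ω) u ∧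
          holderSeminorm γ Ω u ≤ C * (holderNorm β (frontier Ω) g + linftyNorm Ω f)) ∧
        (∀ β γ : ℝ, 0 ≤ γ → γ ≤ asymmetryExponent a → 0 ≤ β → β ≤ 1 → γ ≤ (1 + β) / 2 →
          boundaryC1HolderNorm β Ω g < ∞ →
          HolderOn γ (closure Ω) u ∧
          holderSeminorm γ Ω u ≤ C * (boundaryC1HolderNorm β Ω g + linftyNorm Ω f)) := by
  refine ⟨holderConstant R ((m + 1) * aMean), holderConstant_pos hR, ?_⟩
  rintro a Ω f g u ha has rfl h hS
  have hsum : (m + 1) * weightMean a = ∑ i, a i := mul_div_cancel₀ _ (by positivity)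
  rw [hsum]
  exact ⟨fun β γ hγ hγa hβ hγβ => h.holderOn_of_holderOn ha has hS hγ hγa hγβ (by linarith),
    fun β γ hγ hγa hβ₀ hβ₁ hγβ =>
      h.holderOn_of_boundaryC1HolderNorm_lt_top ha has hR.ne' hS hγ hγa hβ₀ hβ₁ hγβ⟩

theorem mainTheorem8 (m : ℕ) :
    -- general estimate, exterior sphere condition, `g ∈ C^β(∂Ω)`
    (∀ aStar aMean R β : ℝ, 0 < R → 0 < β → β ≤ 1 →
      ∃ C : ℝ≥0, 0 < C ∧
        ∀ (a : Fin (m + 1) → ℝ) (Ω : Set (Rn (m + 1))) (f g u : Rn (m + 1) → ℝ),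
          IsWeight a → IsAsymmetric a → weightStar a = aStar → weightMean a = aMean →
          IsDirichletSolution a Ω f g u → UniformExteriorSphere Ω R →
          HolderOn β (frontier Ω) g →
          HolderOn (min (asymmetryExponent a) (β / 2)) (closure Ω) u ∧
          holderSeminorm (min (asymmetryExponent a) (β / 2)) Ω u ≤
            C * (holderNorm β (frontier Ω) g + linftyNorm Ω f)) ∧
    -- general estimate, in addition Lipschitz boundary, `g ∈ C^{1,β}(∂Ω)`
    (∀ (aStar aMean R β : ℝ) (L : ℝ≥0), 0 < R → 0 ≤ β → β < 1 →
      ∃ C : ℝ≥0, 0 < C ∧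
        ∀ (a : Fin (m + 1) → ℝ) (Ω : Set (Rn (m + 1))) (f g u : Rn (m + 1) → ℝ),
          IsWeight a → IsAsymmetric a → weightStar a = aStar → weightMean a = aMean →
          IsDirichletSolution a Ω f g u → UniformExteriorSphere Ω R →
          UniformLipschitzBoundary Ω L →
          boundaryC1HolderNorm β Ω g < ∞ →
          HolderOn (min (asymmetryExponent a) ((1 + β) / 2)) (closure Ω) u ∧
          holderSeminorm (min (asymmetryExponent a) ((1 + β) / 2)) Ω u ≤
            C * (boundaryC1HolderNorm β Ω g + linftyNorm Ω f)) ∧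
    -- exponent `α ∈ (0, 1/2]`, exterior sphere condition, `g ∈ C^{2α}(∂Ω)`
    (∀ aFirst hatFirst aLast hatLast aMean R α : ℝ, 0 < R → 0 < α → α ≤ 1 / 2 →
      ∃ C : ℝ≥0, 0 < C ∧
        ∀ (a : Fin (m + 1) → ℝ) (Ω : Set (Rn (m + 1))) (f g u : Rn (m + 1) → ℝ),
          IsWeight a → IsAsymmetric a → a 0 = aFirst → weightHat a 0 = hatFirst →
          a (Fin.last m) = aLast → weightHat a (Fin.last m) = hatLast →
          weightMean a = aMean → asymmetryExponent a = α →
          IsDirichletSolution a Ω f g u → UniformExteriorSphere Ω R →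
          HolderOn (2 * α) (frontier Ω) g →
          HolderOn α (closure Ω) u ∧
          holderSeminorm α Ω u ≤
            C * (holderNorm (2 * α) (frontier Ω) g + linftyNorm Ω f)) ∧
    -- exponent `α ∈ [1/2, 1]`, in addition Lipschitz boundary, `g ∈ C^{1,2α-1}(∂Ω)`
    (∀ (aFirst hatFirst aLast hatLast aMean R α : ℝ) (L : ℝ≥0), 0 < R → 1 / 2 ≤ α → α ≤ 1 →
      ∃ C : ℝ≥0, 0 < C ∧
        ∀ (a : Fin (m + 1) → ℝ) (Ω : Set (Rn (m + 1))) (f g u : Rn (m + 1) → ℝ),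
          IsWeight a → IsAsymmetric a → a 0 = aFirst → weightHat a 0 = hatFirst →
          a (Fin.last m) = aLast → weightHat a (Fin.last m) = hatLast →
          weightMean a = aMean → asymmetryExponent a = α →
          IsDirichletSolution a Ω f g u → UniformExteriorSphere Ω R →
          UniformLipschitzBoundary Ω L →
          boundaryC1HolderNorm (2 * α - 1) Ω g < ∞ →
          holderSeminorm α Ω u ≤
            C * (boundaryC1HolderNorm (2 * α - 1) Ω g + linftyNorm Ω f)) := by
  refine ⟨fun _ aMean R β hR hβ hβ₁ => ?_, fun _ aMean R β _ hR hβ hβ₁ => ?_,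
    fun _ _ _ _ aMean R α hR hα hα₁ => ?_, fun _ _ _ _ aMean R α _ hR hα hα₁ => ?_⟩ <;>
    obtain ⟨C, hC, hest⟩ := mainTheorem8_general m aMean hR <;>
    refine ⟨C, hC, fun a Ω f g u ha has => ?_⟩
  · exact fun _ hmean h hS => (hest a Ω f g u ha has hmean h hS).1 β _
      (le_min (asymmetryExponent_nonneg ha has) (by positivity)) (min_le_left _ _) hβ₁
      (min_le_right _ _)
  · exact fun _ hmean h hS _ => (hest a Ω f g u ha has hmean h hS).2 β _
      (le_min (asymmetryExponent_nonneg ha has) (by positivity)) (min_le_left _ _) hβ hβ₁.le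
      (min_le_right _ _)
  · exact fun _ _ _ _ hmean hα h hS => (hest a Ω f g u ha has hmean h hS).1 (2 * α) α
      (by positivity) hα.ge (by linarith) (by linarith)
  · exact fun _ _ _ _ hmean hα h hS _ hg => ((hest a Ω f g u ha has hmean h hS).2 (2 * α - 1) α
      (by linarith) hα.ge (by linarith) (by linarith) (by linarith) hg).2
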